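/- Let $X$ be a compact Hausdorff space that is power homogeneous, i.e. there is a cardinal $\kappa\ge 1$ such that for any two points $p,q$ of the product space $X^\kappa$ some homeomorphism $h:X^\kappa\to X^\kappa$ satisfies $h(p)=q$. Suppose that $X$ has a countable cover consisting of dense, countably tight subspaces. Then $X$ is almost countably tight, and moreover $|X|\le\mathfrak c=2^{\aleph_0}$. Here the tightness $t(Y)$ of a space $Y$ is the least infinite cardinal $\kappa$ such that whenever $A\subseteq Y$ and $x\in\overline{A}$ there is $B\subseteq A$ with $|B|\le\kappa$ and $x\in\overline{B}$; $Y$ is countably tight if $t(Y)=\aleph_0$. For $A\subseteq X$, the $\kappa$-closure of $A$ is $cl_\kappa A=\bigcup\{\overline{B}: B\subseteq A,\ |B|\le\kappa\}$. The almost tightness $at(X)$ is the least infinite cardinal $\kappa$ for which there is a cover $\mathcal C$ of $X$ with $|\mathcal C|\le\kappa$ such that $t(C)\le\kappa$ and $X=cl_\kappa C$ for all $C\in\mathcal C$; $X$ is almost countably tight if $at(X)=\aleph_0$. -/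

import Mathlib

open Cardinal

universe u v

/-- `X` is homogeneous: every point can be moved to every other one by an autohomeomorphism. -/
def IsHomogeneousSpace (X : Type u) [TopologicalSpace X] : Prop :=
  ∀ x y : X, ∃ h : X ≃ₜ X, h x = y

/-- `X` is power homogeneous: some power `X ^ ι` (product topology) with a nonempty index set `ι`
is homogeneous. The empty power is a single point, hence is excluded. The universe of `ι` is
independent of that of `X`. -/
def IsPowerHomogeneous (X : Type u) [TopologicalSpace X] : Prop :=
  ∃ ι : Type v, Nonempty ι ∧ IsHomogeneousSpace (ι → X)

/-- The `κ`-closure of `A`: the union of the closures of all subsets of `A` of size at most `κ`. -/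
def kappaClosure {X : Type u} [TopologicalSpace X] (κ : Cardinal.{u}) (A : Set X) : Set X :=
  {x | ∃ B : Set X, B ⊆ A ∧ #B ≤ κ ∧ x ∈ closure B}

/-- The tightness `t(X)`: the least infinite cardinal `κ` such that every point in the closure of
a set `A` is in the closure of a subset of `A` of size at most `κ`. -/
noncomputable def tightness (X : Type u) [TopologicalSpace X] : Cardinal.{u} :=
  sInf {κ | ℵ₀ ≤ κ ∧ ∀ A : Set X, ∀ x ∈ closure A, ∃ B : Set X, B ⊆ A ∧ #B ≤ κ ∧ x ∈ closure B}

/-- `X` is countably tight: `t(X) = ℵ₀`. -/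
def IsCountablyTight (X : Type u) [TopologicalSpace X] : Prop :=
  tightness X = ℵ₀

/-- The almost tightness `at(X)`: the least infinite cardinal `κ` for which `X` has a cover by at
most `κ` many subspaces `C`, each of tightness at most `κ` and with `κ`-closure equal to `X`. -/
noncomputable def almostTightness (X : Type u) [TopologicalSpace X] : Cardinal.{u} :=
  sInf {κ | ℵ₀ ≤ κ ∧ ∃ 𝒞 : Set (Set X), ⋃₀ 𝒞 = Set.univ ∧ #𝒞 ≤ κ ∧
    ∀ C ∈ 𝒞, tightness C ≤ κ ∧ kappaClosure κ C = Set.univ}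

/-- `X` is almost countably tight: `at(X) = ℵ₀`. -/
def IsAlmostCountablyTight (X : Type u) [TopologicalSpace X] : Prop :=
  almostTightness X = ℵ₀

/-!
Let `X` be the union of dense countably tight subspaces `C m`, and let `X ^ ι` be homogeneous.

*Countable π-character.* A closed subset of `X` cannot map onto an uncountable Cantor cube
(`not_surjective_of_countablyTightOn`), and by Shapirovskii's construction of independent families
(`exists_independent_family`) the points of countable π-character are therefore dense in `X`
(`dense_hasCountablePiBase`). Composing an autohomeomorphism of `X ^ ι` with a projection gives,
for all `p` and `q`, an open map `X ^ ι → X` that sends the constant point `p` to `q`. Closing off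
a countable set of coordinates under such a map (`exists_countable_support_of_open_map`) shows that
countable π-character passes from a dense set of points to all points, and that near points of
countable π-character the map depends on countably many coordinates only. As every `C m` is dense,
each point of `X` is now in the closure of a countable subset of `C m`, so `X` is almost countably
tight.

*Cardinality.* A free sequence of length `ω₁` would contradict the countable tightness of the
pieces, so some nonempty closed Gδ set lies in the closure of a countable set
(`exists_isGδ_subset_closure_countable`). The open maps carry this property to every point
(`exists_isNestedAt_of_open_map`). At most `𝔠` of the resulting Gδ sets cover `X`, so `X` has a
dense set `D` with `#D ≤ 𝔠` (`exists_dense_card_le_continuum`). Finally each point is coded by a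
sequence in `D`, one term for each box of a countable π-base (`card_le_continuum_of_open_maps`),
and `𝔠 ^ ℵ₀ = 𝔠`.
-/

/-! ### Closing-off, fusion and transfinite recursion -/

theorem exists_countable_closed_under {ι : Type*} (φ : Finset ι → Set ι)
    (hφ : ∀ F, (φ F).Countable) :
    ∃ A : Set ι, A.Countable ∧ ∀ F : Finset ι, (F : Set ι) ⊆ A → φ F ⊆ A := by
  let step : Set ι → Set ι := fun A => A ∪ ⋃ F ∈ {F : Finset ι | (F : Set ι) ⊆ A}, φ F
  let a : ℕ → Set ι := fun n => step^[n] ∅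
  have hsucc : ∀ n, a (n + 1) = step (a n) := fun n => Function.iterate_succ_apply' _ _ _
  have hmono : Monotone a := by
    refine monotone_nat_of_le_succ fun n => ?_
    rw [hsucc]
    exact Set.subset_union_left
  have hcount : ∀ n, (a n).Countable := by
    intro n
    induction n with
    | zero => exact Set.countable_empty
    | succ n ih =>
      rw [hsucc]
      refine ih.union (Set.Countable.biUnion ?_ fun F _ => hφ F)
      have h := (Set.countable_ofPred_finite_subset ih).preimage_of_injOn
        (f := fun F : Finset ι => (F : Set ι)) (Finset.coe_injective.injOn)
      refine h.mono fun F hF => ?_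
      exact ⟨F.finite_toSet, hF⟩
  refine ⟨⋃ n, a n, Set.countable_iUnion hcount, fun F hF => ?_⟩
  obtain ⟨n, hn⟩ : ∃ n, (F : Set ι) ⊆ a n :=
    hmono.directed_le.exists_mem_subset_of_finset_subset_biUnion hF
  refine subset_trans ?_ (Set.subset_iUnion a (n + 1))
  rw [hsucc]
  exact (Set.subset_biUnion_of_mem (u := fun F => φ F)
    (show F ∈ {F : Finset ι | (F : Set ι) ⊆ a n} from hn)).trans Set.subset_union_right

/-- In a preorder in which every decreasing sequence has a lower bound, one element lies below
members of each of countably many dense sets, all of them below a given element. -/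
theorem exists_fusion {P : Type*} [Preorder P]
    (hlim : ∀ c : ℕ → P, Antitone c → ∃ b, ∀ n, b ≤ c n) (D : ℕ → P → Prop)
    (hD : ∀ n c, ∃ c' ≤ c, D n c') (c : P) : ∃ b, ∀ n, ∃ c', b ≤ c' ∧ c' ≤ c ∧ D n c' := by
  choose g hg hDg using hD
  let a : ℕ → P := fun n => Nat.rec c (fun n p => g n p) n
  have ha : Antitone a := antitone_nat_of_succ_le fun n => hg n (a n)
  obtain ⟨b, hb⟩ := hlim a ha
  exact ⟨b, fun n => ⟨a (n + 1), hb (n + 1), ha (Nat.zero_le (n + 1)), hDg n (a n)⟩⟩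

/-- Transfinite recursion with choices: `R α prev t` says that `t` may follow the values `prev`. -/
theorem exists_transfinite_sequence {W T : Type*} [LT W] [WellFoundedLT W]
    (R : ∀ α : W, (∀ β, β < α → T) → T → Prop) (h : ∀ α prev, ∃ t, R α prev t) :
    ∃ F : W → T, ∀ α, R α (fun β _ => F β) (F α) := by
  choose g hg using h
  refine ⟨(wellFounded_lt : WellFounded ((· < ·) : W → W → Prop)).fix g, fun α => ?_⟩
  conv => arg 3; rw [WellFounded.fix_eq]
  exact hg α _

/-- The first uncountable ordinal, as a well-order in an arbitrary universe. -/
theorem exists_omega_one_like : ∃ (W : Type u) (_ : LinearOrder W) (_ : WellFoundedLT W),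
    (∀ α : W, (Set.Iio α).Countable) ∧ ¬ (Set.univ : Set W).Countable ∧ #W = ℵ₁ := by
  refine ⟨(ℵ₁ : Cardinal.{u}).ord.ToType, inferInstance, inferInstance, fun α => ?_, ?_, ?_⟩
  · rw [← le_aleph0_iff_set_countable, ← lt_aleph_one_iff]
    exact (mk_Iio_lt α (by simp)).trans_eq (by simp)
  · rw [← le_aleph0_iff_set_countable, ← lt_aleph_one_iff, mk_univ]
    simp
  · simp

theorem exists_forall_lt_of_countable {W : Type*} [LinearOrder W]
    (hW : ∀ α : W, (Set.Iio α).Countable) (hu : ¬ (Set.univ : Set W).Countable)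
    {J : Set W} (hJ : J.Countable) : ∃ α, ∀ j ∈ J, j < α := by
  by_contra! h
  apply hu
  have : (⋃ j ∈ J, Set.Iic j).Countable := by
    refine hJ.biUnion fun j _ => ?_
    rw [← Set.Iio_insert]
    exact (hW j).insert j
  exact this.mono fun α _ => by
    obtain ⟨j, hj, hle⟩ := h α
    exact Set.mem_biUnion hj hle

/-- The closing-off runs through `ω₁` stages; every sequence appears at a countable stage, and
`𝔠 ^ ℵ₀ = 𝔠` bounds each stage. -/
theorem exists_closed_under_sequences {X : Type u} (B : Set X) (hB : #B ≤ 𝔠)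
    (Φ : (ℕ → X) → Set X) (hΦ : ∀ s, #(Φ s) ≤ 𝔠) :
    ∃ Y : Set X, #Y ≤ 𝔠 ∧ B ⊆ Y ∧ ∀ s : ℕ → X, (∀ n, s n ∈ Y) → Φ s ⊆ Y := by
  obtain ⟨W, _, _, hW, hu, hcard⟩ := exists_omega_one_like.{u}
  have hsmall : ∀ J : Set W, #J ≤ 𝔠 := fun J =>
    (mk_set_le J).trans (hcard.trans_le aleph_one_le_continuum)
  have hunion : ∀ (J : Set W) (G : W → Set X), (∀ j ∈ J, #(G j) ≤ 𝔠) →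
      #(⋃ j ∈ J, G j : Set X) ≤ 𝔠 := by
    intro J G hG
    refine (mk_biUnion_le G J).trans ?_
    refine (mul_le_mul' (hsmall J) (ciSup_le' fun j : J => hG j j.2)).trans ?_
    rw [continuum_mul_self]
  obtain ⟨F, hF⟩ := exists_transfinite_sequence (W := W) (T := Set X)
    (fun α prev t => t = B ∪ ⋃ s ∈ {s : ℕ → X | ∀ n, ∃ β, ∃ h : β < α, s n ∈ prev β h}, Φ s)
    (fun α prev => ⟨_, rfl⟩)
  have hFc : ∀ α, #(F α) ≤ 𝔠 := by
    intro α
    induction α using WellFoundedLT.induction with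
    | ind α ih =>
      rw [hF α]
      refine (mk_union_le _ _).trans ?_
      refine (add_le_add hB ?_).trans_eq continuum_add_self
      refine (mk_biUnion_le _ _).trans ?_
      refine (mul_le_mul' ?_ (ciSup_le' fun j : {s : ℕ → X | ∀ n, ∃ β, ∃ _ : β < α, s n ∈ F β} =>
        hΦ j)).trans_eq continuum_mul_self
      let Z : Set X := ⋃ β ∈ Set.Iio α, F β
      have hZ : #Z ≤ 𝔠 := hunion _ _ fun β hβ => ih β hβ
      have hinj : #{s : ℕ → X | ∀ n, ∃ β, ∃ _ : β < α, s n ∈ F β} ≤ #(ℕ → Z) := by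
        refine mk_le_of_injective (f := fun s n => ⟨s.1 n, ?_⟩) ?_
        · obtain ⟨β, h, hs⟩ := s.2 n
          exact Set.mem_biUnion (show β ∈ Set.Iio α from h) hs
        · intro s t hst
          ext n
          exact congrArg Subtype.val (congrFun hst n)
      refine hinj.trans ?_
      have : #(ℕ → Z) = #Z ^ (ℵ₀ : Cardinal.{u}) := by simp
      rw [this, ← continuum_power_aleph0]
      exact power_le_power_right hZ
  refine ⟨⋃ α ∈ (Set.univ : Set W), F α, hunion _ _ fun α _ => hFc α, ?_, ?_⟩
  · intro x hx
    obtain ⟨α, -⟩ := exists_forall_lt_of_countable hW hu Set.countable_empty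
    refine Set.mem_biUnion (Set.mem_univ α) ?_
    rw [hF α]
    exact Or.inl hx
  · intro s hs x hx
    have hs' : ∀ n, ∃ α, s n ∈ F α := fun n => by simpa using hs n
    choose a ha using hs'
    obtain ⟨α, hα⟩ := exists_forall_lt_of_countable hW hu (Set.countable_range a)
    refine Set.mem_biUnion (Set.mem_univ α) ?_
    rw [hF α]
    exact Or.inr (Set.mem_biUnion (show s ∈ {s : ℕ → X | ∀ n, ∃ β, ∃ _ : β < α, s n ∈ F β} from
      fun n => ⟨a n, hα _ ⟨n, rfl⟩, ha n⟩) hx)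

/-! ### Countable local π-bases and open maps on powers -/

/-- The sequence `U` enumerates a local π-base at `x`: nonempty open sets, not required to
contain `x`, such that every neighbourhood of `x` includes one of them. -/
def IsLocalPiBase {X : Type*} [TopologicalSpace X] (x : X) (U : ℕ → Set X) : Prop :=
  (∀ n, IsOpen (U n) ∧ (U n).Nonempty) ∧ ∀ O ∈ nhds x, ∃ n, U n ⊆ O

/-- `x` has countable π-character. -/
def HasCountablePiBase {X : Type*} [TopologicalSpace X] (x : X) : Prop :=
  ∃ U : ℕ → Set X, IsLocalPiBase x U

/-- The index `0` can be reserved for the whole space, so that finitely supported sequences of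
indices describe basic boxes in a power. -/
theorem HasCountablePiBase.exists_zero_eq_univ {X : Type*} [TopologicalSpace X] {x : X}
    (h : HasCountablePiBase x) : ∃ U : ℕ → Set X, IsLocalPiBase x U ∧ U 0 = Set.univ := by
  obtain ⟨U, hU, hx⟩ := h
  refine ⟨fun n => Nat.casesOn n Set.univ U, ⟨fun n => ?_, fun O hO => ?_⟩, rfl⟩
  · cases n with
    | zero => exact ⟨isOpen_univ, ⟨x, trivial⟩⟩
    | succ n => exact hU n
  · obtain ⟨n, hn⟩ := hx O hO
    exact ⟨n + 1, hn⟩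

theorem exists_finset_forall_eq_mem {ι X : Type*} [TopologicalSpace X] {O : Set (ι → X)}
    (hO : IsOpen O) {z : ι → X} (hz : z ∈ O) :
    ∃ F : Finset ι, ∃ W : ι → Set X, (∀ i, IsOpen (W i) ∧ z i ∈ W i) ∧
      ∀ w : ι → X, (∀ i ∈ F, w i ∈ W i) → w ∈ O := by
  classical
  obtain ⟨F, W, hW, hsub⟩ := isOpen_pi_iff.mp hO z hz
  refine ⟨F, fun i => if i ∈ F then W i else Set.univ, fun i => ?_, fun w hw => ?_⟩
  · by_cases hi : i ∈ F
    · simpa [hi] using hW i hi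
    · simp [hi]
  · refine hsub fun i hi => ?_
    have := hw i hi
    simpa only [if_pos (show i ∈ F from hi)] using this

theorem countable_setOf_finsupp_support_subset {ι : Type*} {A : Set ι} (hA : A.Countable) :
    {s : ι →₀ ℕ | (s.support : Set ι) ⊆ A}.Countable := by
  have := hA.to_subtype
  refine (Set.countable_range fun t : A →₀ ℕ => t.mapDomain Subtype.val).mono ?_
  intro s hs
  refine ⟨s.comapDomain Subtype.val Subtype.val_injective.injOn, ?_⟩
  refine Finsupp.mapDomain_comapDomain _ Subtype.val_injective _ ?_
  simpa using hs

/-- The local structure of an open map `f` on a power at a point with coordinates of countable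
π-character. One point `d s` of a dense set `D` is picked in the image of each box `s` of the
π-base; for a suitable countable set `A` of coordinates the points `d s` with `s` supported in `A`
accumulate at `f x'`, for every `x'` that agrees with `x` on `A`, along boxes that depend on
finitely many coordinates in `A` only. -/
theorem exists_countable_support_of_open_map {ι : Type*} {X Y : Type*} [TopologicalSpace X]
    [TopologicalSpace Y] {f : (ι → X) → Y} (hf : Continuous f) (hfo : IsOpenMap f) (x : ι → X)
    (U : ι → ℕ → Set X) (hU : ∀ i, IsLocalPiBase (x i) (U i)) (hU0 : ∀ i, U i 0 = Set.univ)
    {D : Set Y} (hD : Dense D) (hDpi : ∀ y ∈ D, HasCountablePiBase y) :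
    ∃ A : Set ι, A.Countable ∧ ∃ d : (ι →₀ ℕ) → Y, (∀ s, d s ∈ D) ∧
      ∀ x' : ι → X, (∀ i ∈ A, x' i = x i) → ∀ O ∈ nhds (f x'),
        ∃ (G : Finset ι) (T : ι → Set X), (∀ i, T i ∈ nhds (x i)) ∧
          ∀ s : ι →₀ ℕ, (s.support : Set ι) ⊆ A → (∀ i ∈ G, i ∈ A → U i (s i) ⊆ T i) →
            d s ∈ closure O := by
  classical
  let box : (ι →₀ ℕ) → Set (ι → X) := fun s => {z | ∀ i, z i ∈ U i (s i)}
  have hbox_open : ∀ s, IsOpen (box s) := by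
    intro s
    have : box s = Set.pi (s.support : Set ι) fun i => U i (s i) := by
      ext z
      refine ⟨fun h i _ => h i, fun h i => ?_⟩
      by_cases hi : i ∈ s.support
      · exact h i hi
      · rw [Finsupp.notMem_support_iff.mp hi, hU0]
        trivial
    rw [this]
    exact isOpen_set_pi s.support.finite_toSet fun i _ => ((hU i).1 _).1
  have hbox_ne : ∀ s, (box s).Nonempty := fun s =>
    ⟨fun i => ((hU i).1 (s i)).2.some, fun i => ((hU i).1 (s i)).2.some_mem⟩
  have hd : ∀ s, ∃ y ∈ D, y ∈ f '' box s := fun s => by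
    obtain ⟨y, hy, hyD⟩ := hD.inter_open_nonempty _ (hfo _ (hbox_open s)) ((hbox_ne s).image f)
    exact ⟨y, hyD, hy⟩
  choose d hdD hdbox using hd
  choose Q hQ using fun s => hDpi (d s) (hdD s)
  -- Each π-base element at `d s` inside `f '' box s` is hit from the box by a point `z`,
  -- and this depends on finitely many coordinates of `z` only.
  have hz : ∀ s k, ∃ (z : ι → X) (F : Finset ι), Q s k ⊆ f '' box s →
      z ∈ box s ∧ ∀ w : ι → X, (∀ i ∈ F, w i = z i) → f w ∈ Q s k := by
    intro s k
    by_cases h : Q s k ⊆ f '' box s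
    · obtain ⟨y, hy⟩ := ((hQ s).1 k).2
      obtain ⟨z, hz, rfl⟩ := h hy
      obtain ⟨F, W, hW, hF⟩ :=
        exists_finset_forall_eq_mem (((hQ s).1 k).1.preimage hf) (z := z) hy
      exact ⟨z, F, fun _ => ⟨hz, fun w hw => hF w fun i hi => hw i hi ▸ (hW i).2⟩⟩
    · exact ⟨x, ∅, fun h' => absurd h' h⟩
  choose z F hzF using hz
  obtain ⟨A, hA, hAcl⟩ := exists_countable_closed_under
    (fun G : Finset ι => ⋃ s ∈ {s : ι →₀ ℕ | (s.support : Set ι) ⊆ G}, ⋃ k, (F s k : Set ι))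
    (fun G => (countable_setOf_finsupp_support_subset G.countable_toSet).biUnion fun s _ =>
      Set.countable_iUnion fun k => (F s k).countable_toSet)
  have hFA : ∀ s : ι →₀ ℕ, (s.support : Set ι) ⊆ A → ∀ k, (F s k : Set ι) ⊆ A := by
    intro s hs k i hi
    exact hAcl s.support hs (Set.mem_biUnion (by simp)
      (Set.mem_iUnion.mpr ⟨k, hi⟩))
  refine ⟨A, hA, d, hdD, fun x' hx' O hO => ?_⟩
  obtain ⟨O', hO'O, hO', hxO'⟩ := mem_nhds_iff.mp hO
  obtain ⟨G, W, hW, hG⟩ := exists_finset_forall_eq_mem (hO'.preimage hf) (z := x') hxO'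
  refine ⟨G, fun i => if i ∈ A then W i else Set.univ, fun i => ?_, fun s hs hsT => ?_⟩
  · by_cases hi : i ∈ A
    · simp only [if_pos hi, ← hx' i hi]
      exact (hW i).1.mem_nhds (hW i).2
    · simp only [if_neg hi, Filter.univ_mem]
  · by_contra hcl
    have hnhds : (closure O)ᶜ ∩ f '' box s ∈ nhds (d s) :=
      Filter.inter_mem (isClosed_closure.isOpen_compl.mem_nhds hcl)
        ((hfo _ (hbox_open s)).mem_nhds (hdbox s))
    obtain ⟨k, hk⟩ := (hQ s).2 _ hnhds
    obtain ⟨hzbox, hzQ⟩ := hzF s k (hk.trans Set.inter_subset_right)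
    -- Glue the witness on `A` to `x'` off `A`.
    let w : ι → X := fun i => if i ∈ A then z s k i else x' i
    have hwQ : f w ∈ Q s k := hzQ w fun i hi => if_pos (hFA s hs k hi)
    have hwO : f w ∈ O' := by
      refine hG w fun i hi => ?_
      by_cases hiA : i ∈ A
      · have := hsT i hi hiA (hzbox i)
        simpa [w, hiA] using this
      · simpa [w, hiA] using (hW i).2
    exact (hk hwQ).1 (subset_closure (hO'O hwO))

theorem exists_finsupp_forall_subset {ι X : Type*} [TopologicalSpace X] {x : ι → X}
    {U : ι → ℕ → Set X} (hU : ∀ i, IsLocalPiBase (x i) (U i)) (A : Set ι) (G : Finset ι)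
    {T : ι → Set X} (hT : ∀ i, T i ∈ nhds (x i)) :
    ∃ s : ι →₀ ℕ, (s.support : Set ι) ⊆ A ∧ ∀ i ∈ G, i ∈ A → U i (s i) ⊆ T i := by
  classical
  choose n hn using fun i => (hU i).2 (T i) (hT i)
  refine ⟨Finsupp.onFinset (G.filter (· ∈ A)) (fun i => if i ∈ G ∧ i ∈ A then n i else 0) ?_,
    ?_, fun i hi hiA => ?_⟩
  · intro i hi
    by_contra h
    simp only [Finset.mem_filter] at h
    exact hi (if_neg h)
  · intro i hi
    have := Finsupp.support_onFinset_subset hi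
    exact (Finset.mem_filter.mp this).2
  · simpa [hi, hiA] using hn i

/-- An open map on a power depends, near a point with coordinates of countable π-character, on
countably many coordinates. -/
theorem exists_countable_forall_eq {ι : Type*} {X Y : Type*} [TopologicalSpace X]
    [TopologicalSpace Y] [T25Space Y] {f : (ι → X) → Y} (hf : Continuous f) (hfo : IsOpenMap f)
    (x : ι → X) (hx : ∀ i, HasCountablePiBase (x i))
    {D : Set Y} (hD : Dense D) (hDpi : ∀ y ∈ D, HasCountablePiBase y) :
    ∃ A : Set ι, A.Countable ∧ ∀ x' : ι → X, (∀ i ∈ A, x' i = x i) → f x' = f x := by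
  classical
  choose U hU hU0 using fun i => (hx i).exists_zero_eq_univ
  obtain ⟨A, hA, d, -, hd⟩ := exists_countable_support_of_open_map hf hfo x U hU hU0 hD hDpi
  refine ⟨A, hA, fun x' hx' => ?_⟩
  by_contra hne
  obtain ⟨O, hO, O', hO', hdisj⟩ := exists_nhds_disjoint_closure hne
  obtain ⟨G, T, hT, h⟩ := hd x' hx' O hO
  obtain ⟨G', T', hT', h'⟩ := hd x (fun _ _ => rfl) O' hO'
  obtain ⟨s, hsA, hs⟩ := exists_finsupp_forall_subset hU A (G ∪ G')
    (T := fun i => T i ∩ T' i) fun i => Filter.inter_mem (hT i) (hT' i)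
  refine Set.disjoint_left.mp hdisj (h s hsA fun i hi hiA => ?_) (h' s hsA fun i hi hiA => ?_)
  · exact (hs i (Finset.mem_union_left _ hi) hiA).trans Set.inter_subset_left
  · exact (hs i (Finset.mem_union_right _ hi) hiA).trans Set.inter_subset_right

theorem hasCountablePiBase_of_open_map {ι : Type*} {X Y : Type*} [TopologicalSpace X]
    [TopologicalSpace Y] [RegularSpace Y] {f : (ι → X) → Y} (hf : Continuous f)
    (hfo : IsOpenMap f) (x : ι → X) (hx : ∀ i, HasCountablePiBase (x i))
    {D : Set Y} (hD : Dense D) (hDpi : ∀ y ∈ D, HasCountablePiBase y) :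
    HasCountablePiBase (f x) := by
  choose U hU hU0 using fun i => (hx i).exists_zero_eq_univ
  obtain ⟨A, hA, d, hdD, hd⟩ := exists_countable_support_of_open_map hf hfo x U hU hU0 hD hDpi
  choose Q hQ using fun s => hDpi (d s) (hdD s)
  have hS := countable_setOf_finsupp_support_subset hA
  obtain ⟨e, he⟩ := hS.exists_eq_range ⟨0, by simp⟩
  refine ⟨fun n => Q (e n.unpair.1) n.unpair.2, fun n => (hQ _).1 _, fun O hO => ?_⟩
  obtain ⟨O'', hO''O', hO'', hxO''⟩ := mem_nhds_iff.mp hO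
  obtain ⟨C, hC, hCc, hCO⟩ := exists_mem_nhds_isClosed_subset (hO''.mem_nhds hxO'')
  obtain ⟨G, T, hT, h⟩ := hd x (fun _ _ => rfl) C hC
  obtain ⟨s, hsA, hs⟩ := exists_finsupp_forall_subset hU A G hT
  have hds : d s ∈ O'' := hCO (hCc.closure_eq ▸ h s hsA hs)
  obtain ⟨k, hk⟩ := (hQ s).2 O'' (hO''.mem_nhds hds)
  obtain ⟨m, rfl⟩ : s ∈ Set.range e := he ▸ hsA
  refine ⟨Nat.pair m k, ?_⟩
  simpa using hk.trans hO''O'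

/-! ### Countably tight pieces and maps onto Cantor cubes -/

/-- The subspace `C` is countably tight, phrased with closures in the ambient space. -/
def CountablyTightOn {X : Type*} [TopologicalSpace X] (C : Set X) : Prop :=
  ∀ A ⊆ C, ∀ x ∈ C, x ∈ closure A → ∃ B ⊆ A, B.Countable ∧ x ∈ closure B

theorem CountablyTightOn.preimage_val {X : Type*} [TopologicalSpace X] {C : Set X}
    (hC : CountablyTightOn C) (K : Set X) :
    CountablyTightOn (Subtype.val ⁻¹' C : Set K) := by
  intro A hA x hx hxA
  have hemb : Topology.IsEmbedding (Subtype.val : K → X) := Topology.IsEmbedding.subtypeVal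
  rw [hemb.closure_eq_preimage_closure_image] at hxA
  obtain ⟨B, hB, hBc, hxB⟩ := hC (Subtype.val '' A) (Set.image_subset_iff.mpr hA) x hx hxA
  refine ⟨Subtype.val ⁻¹' B, fun y hy => ?_, hBc.preimage Subtype.val_injective, ?_⟩
  · obtain ⟨a, ha, hay⟩ := hB hy
    rwa [← Subtype.ext hay]
  · rw [hemb.closure_eq_preimage_closure_image, Set.mem_preimage, Set.image_preimage_eq_of_subset]
    · exact hxB
    · intro b hb
      obtain ⟨a, -, rfl⟩ := hB hb
      exact ⟨a, rfl⟩

/-- Countably many points of an uncountable Cantor cube do not represent all classes modulo changes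
on countable sets. -/
theorem exists_forall_uncountable_ne {T : Type*} [Uncountable T] (q : ℕ → T → Bool) :
    ∃ p : T → Bool, ∀ m, ¬ {α | p α ≠ q m α}.Countable := by
  obtain ⟨e⟩ : Nonempty (T × ℕ ≃ T) := by
    rw [← Cardinal.lift_mk_eq']
    simp
  refine ⟨fun α => !q (e.symm α).2 α, fun m hm => ?_⟩
  have : (Set.range fun t : T => e (t, m)).Countable := by
    refine hm.mono ?_
    rintro _ ⟨t, rfl⟩
    simp
  have h2 := this.preimage_of_injOn (f := fun t : T => e (t, m))
    (fun a _ b _ h => by simpa using h)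
  exact Set.not_countable_univ (by simpa only [Set.preimage_range] using h2)

section CantorCube

variable {K T : Type*} [TopologicalSpace K]

/-- A closed set `L` together with a countable partial function `s` on `A`, such that the image of
`L` under `f` contains the whole cylinder of extensions of `s`. Ordered by refinement. -/
structure CylinderCondition (f : K → T → Bool) where
  L : Set K
  A : Set T
  s : T → Bool
  isClosed : IsClosed L
  countable : A.Countable
  hits : ∀ σ : T → Bool, (∀ α ∈ A, σ α = s α) → ∃ x ∈ L, f x = σ

instance (f : K → T → Bool) : Preorder (CylinderCondition f) where
  le c c' := c.L ⊆ c'.L ∧ c'.A ⊆ c.A ∧ ∀ α ∈ c'.A, c.s α = c'.s α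
  le_refl c := ⟨subset_rfl, subset_rfl, fun _ _ => rfl⟩
  le_trans a b c hab hbc := ⟨hab.1.trans hbc.1, hbc.2.1.trans hab.2.1, fun α hα =>
    (hab.2.2 α (hbc.2.1 hα)).trans (hbc.2.2 α hα)⟩

theorem CylinderCondition.exists_lowerBound [CompactSpace K] {f : K → T → Bool}
    (hf : Continuous f) (c : ℕ → CylinderCondition f) (hc : Antitone c) : ∃ b, ∀ n, b ≤ c n := by
  classical
  let s : T → Bool := fun α => if h : ∃ n, α ∈ (c n).A then (c (Nat.find h)).s α else false
  have hs : ∀ n, ∀ α ∈ (c n).A, s α = (c n).s α := by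
    intro n α hα
    have h : ∃ n, α ∈ (c n).A := ⟨n, hα⟩
    simp only [s, dif_pos h]
    exact ((hc (Nat.find_min' h hα)).2.2 α (Nat.find_spec h)).symm
  refine ⟨⟨⋂ n, (c n).L, ⋃ n, (c n).A, s, isClosed_iInter fun n => (c n).isClosed,
    Set.countable_iUnion fun n => (c n).countable, fun σ hσ => ?_⟩, fun n => ?_⟩
  · have hfib : IsClosed (f ⁻¹' {σ}) := isClosed_singleton.preimage hf
    obtain ⟨x, hx⟩ := IsCompact.nonempty_iInter_of_sequence_nonempty_isCompact_isClosed
      (fun n => (c n).L ∩ f ⁻¹' {σ})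
      (fun n => Set.inter_subset_inter_left _ (hc n.le_succ).1)
      (fun n => by
        obtain ⟨x, hx, hxσ⟩ := (c n).hits σ fun α hα =>
          (hσ α (Set.mem_iUnion.mpr ⟨n, hα⟩)).trans (hs n α hα)
        exact ⟨x, hx, hxσ⟩)
      ((c 0).isClosed.inter hfib).isCompact (fun n => (c n).isClosed.inter hfib)
    rw [Set.mem_iInter] at hx
    exact ⟨x, Set.mem_iInter.mpr fun n => (hx n).1, (hx 0).2⟩
  · exact ⟨Set.iInter_subset _ n, Set.subset_iUnion (fun n => (c n).A) n, hs n⟩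

/-- The points whose image differs from `q` on a countable set; for the identity of a Cantor cube,
the `Σ`-product around `q`. -/
def sigmaFiber (f : K → T → Bool) (q : T → Bool) : Set K :=
  {x | {α | f x α ≠ q α}.Countable}

theorem closure_subset_sigmaFiber {f : K → T → Bool} (hf : Continuous f) {q : T → Bool} {B : Set K}
    (hB : B.Countable) (hBq : B ⊆ sigmaFiber f q) : closure B ⊆ sigmaFiber f q := by
  intro x hx
  refine (hB.biUnion fun b hb => hBq hb).mono fun α hα => ?_
  by_contra h
  simp only [Set.mem_iUnion, not_exists] at h
  refine hα ?_
  have hcl : IsClosed {y | f y α = q α} :=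
    isClosed_eq ((continuous_apply α).comp hf) continuous_const
  exact closure_minimal (fun b hb => not_not.mp (h b hb)) hcl hx

/-- A compact space with a countable cover by countably tight subspaces does not map onto an
uncountable Cantor cube. A piece that is dense in the preimage of one `Σ`-product is, by
countable tightness, trapped in it; as there are more `Σ`-products than pieces, a Baire category
argument with countably supported cylinders yields a contradiction. -/
theorem not_surjective_of_countablyTightOn [CompactSpace K] [Uncountable T] {f : K → T → Bool}
    (hf : Continuous f) (hfs : Function.Surjective f) (C : ℕ → Set K) (hC : ⋃ m, C m = Set.univ)
    (hCt : ∀ m, CountablyTightOn (C m)) : False := by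
  classical
  let c₀ : CylinderCondition f := ⟨Set.univ, ∅, fun _ => false, isClosed_univ,
    Set.countable_empty, fun σ _ => by
      obtain ⟨x, hx⟩ := hfs σ
      exact ⟨x, trivial, hx⟩⟩
  -- Decide for each piece, below one condition `c`, whether it is trapped in a `Σ`-product.
  let Good : ℕ → CylinderCondition f → Prop := fun m c => ∃ q, C m ∩ c.L ⊆ sigmaFiber f q
  obtain ⟨c, hc⟩ := exists_fusion (CylinderCondition.exists_lowerBound hf)
    (fun m c => Good m c ∨ ∀ c' ≤ c, ¬ Good m c') (fun m c => by
      by_cases h : ∃ c' ≤ c, Good m c'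
      · obtain ⟨c', h, h'⟩ := h
        exact ⟨c', h, Or.inl h'⟩
      · push Not at h
        exact ⟨c, le_rfl, Or.inr h⟩) c₀
  have hc' : ∀ m, Good m c ∨ ∀ c' ≤ c, ¬ Good m c' := by
    intro m
    obtain ⟨d, hd, -, ⟨q, hq⟩ | h⟩ := hc m
    · exact Or.inl ⟨q, (Set.inter_subset_inter_right _ hd.1).trans hq⟩
    · exact Or.inr fun c' hc' => h c' (hc'.trans hd)
  have hq : ∀ m, ∃ q, Good m c → C m ∩ c.L ⊆ sigmaFiber f q := by
    intro m
    by_cases h : Good m c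
    · exact ⟨h.choose, fun _ => h.choose_spec⟩
    · exact ⟨fun _ => false, fun h' => absurd h' h⟩
  choose q hq using hq
  obtain ⟨p, hp⟩ := exists_forall_uncountable_ne q
  let cyl : CylinderCondition f → Set K := fun d => {x | ∀ α ∈ d.A, f x α = d.s α}
  by_cases hdense : ∀ m, ∀ d ≤ c, ∃ d' ≤ d, sigmaFiber f p ∩ C m ∩ d'.L ∩ cyl d' = ∅
  · obtain ⟨b, hb⟩ := exists_fusion (CylinderCondition.exists_lowerBound hf)
      (fun m d => d ≤ c → sigmaFiber f p ∩ C m ∩ d.L ∩ cyl d = ∅) (fun m d => by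
        by_cases h : d ≤ c
        · obtain ⟨d', h1, h2⟩ := hdense m d h
          exact ⟨d', h1, fun _ => h2⟩
        · exact ⟨d, le_rfl, fun h' => absurd h' h⟩) c
    obtain ⟨x, hxL, hxσ⟩ := b.hits (fun α => if α ∈ b.A then b.s α else p α)
      fun α hα => if_pos hα
    obtain ⟨m, hm⟩ := Set.mem_iUnion.mp (hC.symm ▸ Set.mem_univ x : x ∈ ⋃ m, C m)
    obtain ⟨d, hbd, hdc, hd⟩ := hb m
    have hxp : x ∈ sigmaFiber f p := by
      refine b.countable.mono fun α hα => ?_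
      by_contra hαb
      refine hα ?_
      rw [hxσ]
      exact if_neg hαb
    have hx : x ∈ sigmaFiber f p ∩ C m ∩ d.L ∩ cyl d := by
      refine ⟨⟨⟨hxp, hm⟩, hbd.1 hxL⟩, fun α hα => ?_⟩
      rw [hxσ]
      exact (if_pos (hbd.2.1 hα)).trans (hbd.2.2 α hα)
    rw [hd hdc] at hx
    exact hx
  · push Not at hdense
    obtain ⟨m, d, hdc, hd⟩ := hdense
    let D : Set K := sigmaFiber f p ∩ C m ∩ d.L ∩ cyl d
    have hDd : closure D ⊆ d.L := closure_minimal (fun x hx => hx.1.2) d.isClosed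
    -- By density in the cylinder, the closure of `D` is again a condition; it traps `C m`.
    let e : CylinderCondition f := ⟨closure D, d.A, d.s, isClosed_closure, d.countable, by
      intro σ hσ
      have hcl : IsClosed (f '' closure D) := (isClosed_closure.isCompact.image hf).isClosed
      suffices h : σ ∈ closure (f '' closure D) by
        rw [hcl.closure_eq] at h
        exact h
      rw [mem_closure_iff]
      intro O hO hσO
      obtain ⟨F, W, hW, hF⟩ := exists_finset_forall_eq_mem hO hσO
      let d' : CylinderCondition f := ⟨d.L, d.A ∪ F, σ, d.isClosed,
        d.countable.union F.countable_toSet, fun τ hτ => d.hits τ fun α hα =>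
          (hτ α (Or.inl hα)).trans (hσ α hα)⟩
      obtain ⟨y, ⟨hy, hyL⟩, hyc⟩ := hd d' ⟨subset_rfl, Set.subset_union_left, hσ⟩
      refine ⟨f y, hF _ fun α hα => ?_, y, subset_closure ⟨⟨hy, hyL⟩, fun α hα => ?_⟩, rfl⟩
      · rw [hyc α (Or.inr hα)]
        exact (hW α).2
      · exact (hyc α (Or.inl hα)).trans (hσ α hα)⟩
    have hed : e ≤ d := ⟨hDd, subset_rfl, fun _ _ => rfl⟩
    have hgood : Good m e := by
      refine ⟨p, fun x hx => ?_⟩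
      obtain ⟨B, hB, hBc, hxB⟩ := hCt m D (fun y hy => hy.1.1.2) x hx.1 hx.2
      exact closure_subset_sigmaFiber hf hBc (fun y hy => (hB hy).1.1.1) hxB
    rcases hc' m with h | h
    · obtain ⟨y, ⟨⟨hyp, hyC⟩, hyL⟩, -⟩ := hd d le_rfl
      have hyq := hq m h ⟨hyC, hdc.1 hyL⟩
      refine hp m ((hyp.union hyq).mono fun α hα => ?_)
      by_contra hcon
      simp only [Set.mem_union, not_or] at hcon
      exact hα ((not_not.mp hcon.1).symm.trans (not_not.mp hcon.2))
    · exact h e (hed.trans hdc) hgood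

end CantorCube

/-! ### Points of countable π-character are dense -/

/-- If no member of a family of sets lies in a sufficiently small neighbourhood of a point of the
compact set `K`, then two open sets with disjoint closures both meet all members below some
member. -/
theorem exists_open_pair_meeting {X : Type*} [TopologicalSpace X] [NormalSpace X]
    [RegularSpace X] {J : Type*}
    [Preorder J] {K : Set X} (hK : IsCompact K) (P : J → Set X) {S : Set J} (hS : S.Nonempty)
    (hPK : ∀ j ∈ S, (P j).Nonempty ∧ P j ⊆ K) (hP : Antitone P)
    (hsmall : ∀ x ∈ K, ∃ O ∈ nhds x, ∀ j ∈ S, ¬ P j ⊆ O) :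
    ∃ U : Bool → TopologicalSpace.Opens X,
      Disjoint (closure (U true : Set X)) (closure (U false : Set X)) ∧
      ∃ j₀ ∈ S, ∀ j ∈ S, j₀ ≤ j → ∀ b, (P j ∩ U b).Nonempty := by
  -- It suffices to meet a neighbourhood `N i` of one point and the complement of a larger `O i`.
  have hN : ∀ x : X, ∃ N O : Set X, x ∈ K → x ∈ N ∧ IsOpen N ∧ IsOpen O ∧ closure N ⊆ O ∧
      ∀ j ∈ S, ¬ P j ⊆ O := by
    intro x
    by_cases hx : x ∈ K
    · obtain ⟨O, hO, hOS⟩ := hsmall x hx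
      obtain ⟨O', hO'O, hO', hxO'⟩ := mem_nhds_iff.mp hO
      obtain ⟨C, hC, hCc, hCO⟩ := exists_mem_nhds_isClosed_subset (hO'.mem_nhds hxO')
      exact ⟨interior C, O', fun _ => ⟨mem_interior_iff_mem_nhds.mpr hC, isOpen_interior, hO',
        (closure_minimal interior_subset hCc).trans hCO, fun j hj h => hOS j hj (h.trans hO'O)⟩⟩
    · exact ⟨∅, ∅, fun h => absurd h hx⟩
  choose N O hNO using hN
  obtain ⟨t, htK, htcov⟩ := hK.elim_nhds_subcover N fun x hx =>
    (hNO x hx).2.1.mem_nhds (hNO x hx).1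
  by_cases h : ∃ i ∈ t, ∃ j₀ ∈ S, ∀ j ∈ S, j₀ ≤ j → (P j ∩ N i).Nonempty
  · obtain ⟨i, hi, j₀, hj₀, h⟩ := h
    obtain ⟨-, hNo, hO, hcl, hOS⟩ := hNO i (htK i hi)
    obtain ⟨G, hG, hOG, hGN⟩ := normal_exists_closure_subset hO.isClosed_compl
      (isClosed_closure (s := N i)).isOpen_compl (Set.compl_subset_compl.mpr hcl)
    refine ⟨fun b => if b then ⟨N i, hNo⟩ else ⟨G, hG⟩, ?_, j₀, hj₀, fun j hj hle b => ?_⟩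
    · exact (Set.subset_compl_iff_disjoint_left.mp hGN)
    · cases b with
      | true => exact h j hj hle
      | false =>
        obtain ⟨x, hx, hxO⟩ := Set.not_subset.mp (hOS j hj)
        exact ⟨x, hx, hOG hxO⟩
  · push Not at h
    exfalso
    have key : ∀ t' : Finset X, t' ⊆ t → ∃ j ∈ S, ∀ i ∈ t', P j ∩ N i = ∅ := by
      classical
      intro t'
      induction t' using Finset.induction_on with
      | empty =>
        intro _
        obtain ⟨j, hj⟩ := hS
        exact ⟨j, hj, by simp⟩
      | insert a t' _ ih =>
        intro hsub
        obtain ⟨j, hj, hjt⟩ := ih ((Finset.subset_insert _ _).trans hsub)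
        obtain ⟨j', hj', hle, hj'a⟩ := h a (hsub (Finset.mem_insert_self _ _)) j hj
        refine ⟨j', hj', fun i hi => ?_⟩
        rcases Finset.mem_insert.mp hi with rfl | hi
        · exact hj'a
        · exact Set.subset_eq_empty (Set.inter_subset_inter_left _ (hP hle)) (hjt i hi)
    obtain ⟨j, hj, hjt⟩ := key t subset_rfl
    obtain ⟨⟨x, hx⟩, hsub⟩ := hPK j hj
    obtain ⟨i, hi, hxi⟩ := Set.mem_iUnion₂.mp (htcov (hsub hx))
    exact (Set.eq_empty_iff_forall_notMem.mp (hjt i hi)) x ⟨hx, hxi⟩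

/-- The intersection of `V` with the open sets selected by a finite set of choices. -/
def choiceSet {X W : Type*} [TopologicalSpace X] (V : Set X)
    (G : W → Bool → TopologicalSpace.Opens X) (ε : Finset (W × Bool)) : Set X :=
  V ∩ ⋂ a ∈ ε, (G a.1 a.2 : Set X)

theorem choiceSet_antitone {X W : Type*} [TopologicalSpace X] (V : Set X)
    (G : W → Bool → TopologicalSpace.Opens X) : Antitone (choiceSet V G) := fun _ _ h =>
  Set.inter_subset_inter_right _ (Set.biInter_subset_biInter_left h)

theorem choiceSet_congr {X W : Type*} [TopologicalSpace X] {V : Set X}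
    {G G' : W → Bool → TopologicalSpace.Opens X} {ε : Finset (W × Bool)}
    (h : ∀ a ∈ ε, G a.1 = G' a.1) : choiceSet V G ε = choiceSet V G' ε := by
  unfold choiceSet
  congr 1
  exact Set.iInter₂_congr fun a ha => by rw [h a ha]

theorem isOpen_choiceSet {X W : Type*} [TopologicalSpace X] {V : Set X} (hV : IsOpen V)
    (G : W → Bool → TopologicalSpace.Opens X) (ε : Finset (W × Bool)) :
    IsOpen (choiceSet V G ε) :=
  hV.inter (isOpen_biInter_finset fun a _ => (G a.1 a.2).isOpen)

/-- A regressive assignment of finite sets of labels is constant on an uncountable set. -/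
theorem exists_uncountable_fiber {W B : Type*} [LinearOrder W] [WellFoundedLT W] [Countable B]
    (hu : ¬ (Set.univ : Set W).Countable) (ε : W → Finset (W × B))
    (hε : ∀ α, ∀ a ∈ ε α, a.1 < α) : ∃ e, ¬ {α | ε α = e}.Countable := by
  classical
  by_contra! h
  obtain ⟨A, hA, hAcl⟩ := exists_countable_closed_under
    (fun Q : Finset W => {α | ∀ a ∈ ε α, a.1 ∈ Q}) (fun Q => by
      have hc : {e : Finset (W × B) | ∀ a ∈ e, a.1 ∈ Q}.Countable := by
        have h1 : ((Q : Set W) ×ˢ (Set.univ : Set B)).Countable :=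
          Q.countable_toSet.prod Set.countable_univ
        refine ((Set.countable_ofPred_finite_subset h1).preimage_of_injOn
          (f := fun e : Finset (W × B) => (e : Set (W × B))) Finset.coe_injective.injOn).mono ?_
        intro e he
        exact ⟨e.finite_toSet, fun a ha => ⟨he a ha, trivial⟩⟩
      refine (hc.biUnion fun e _ => h e).mono fun α hα => ?_
      exact Set.mem_biUnion (x := ε α) hα rfl)
  have hne : (Aᶜ).Nonempty := by
    rw [Set.nonempty_compl]
    rintro rfl
    exact hu hA
  -- `A` contains all predecessors of its least nonmember `γ`, hence the labels of `ε γ`.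
  let γ := (wellFounded_lt : WellFounded ((· < ·) : W → W → Prop)).min Aᶜ hne
  have hγ : γ ∉ A := WellFounded.min_mem _ Aᶜ hne
  have hlt : ∀ β < γ, β ∈ A := fun β hβ => by
    by_contra hβA
    exact WellFounded.not_lt_min _ _ hβA hβ
  refine hγ (hAcl ((ε γ).image Prod.fst) ?_ fun a ha => Finset.mem_image_of_mem _ ha)
  intro β hβ
  obtain ⟨a, ha, rfl⟩ := Finset.mem_image.mp hβ
  exact hlt _ (hε γ a ha)

/-- If no point of a nonempty open set has countable π-character, then there are uncountably many
pairs of closed sets that are disjoint within each pair and independent between pairs. -/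
theorem exists_independent_family {X : Type*} [TopologicalSpace X] [CompactSpace X] [T2Space X]
    {V : Set X} (hV : IsOpen V) (hVne : V.Nonempty) (hpi : ∀ x ∈ V, ¬ HasCountablePiBase x) :
    ∃ (T : Type) (_ : Uncountable T) (F : T → Bool → Set X), (∀ α b, IsClosed (F α b)) ∧
      (∀ α, Disjoint (F α true) (F α false)) ∧ ∀ σ : T → Bool, (⋂ α, F α (σ α)).Nonempty := by
  classical
  obtain ⟨x₀, hx₀⟩ := hVne
  obtain ⟨C, hC, hCc, hCV⟩ := exists_mem_nhds_isClosed_subset (hV.mem_nhds hx₀)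
  have hV' : IsOpen (interior C) := isOpen_interior
  have hx₀' : x₀ ∈ interior C := mem_interior_iff_mem_nhds.mpr hC
  obtain ⟨W, _, _, hW, hu, -⟩ := exists_omega_one_like.{0}
  let below : W → Set (Finset (W × Bool)) := fun α => {ε | ∀ a ∈ ε, a.1 < α}
  have hbelow : ∀ α, (below α).Countable := by
    intro α
    have h1 : (Set.Iio α ×ˢ (Set.univ : Set Bool)).Countable := (hW α).prod Set.countable_univ
    refine ((Set.countable_ofPred_finite_subset h1).preimage_of_injOn
      (f := fun e : Finset (W × Bool) => (e : Set (W × Bool))) Finset.coe_injective.injOn).mono ?_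
    intro e he
    exact ⟨e.finite_toSet, fun a ha => ⟨he a ha, trivial⟩⟩
  have step : ∀ (α : W) (G : W → Bool → TopologicalSpace.Opens X),
      ∃ t : (Bool → TopologicalSpace.Opens X) × Finset (W × Bool),
        Disjoint (closure (t.1 true : Set X)) (closure (t.1 false : Set X)) ∧ t.2 ∈ below α ∧
        (choiceSet (interior C) G t.2).Nonempty ∧ ∀ ε ∈ below α, t.2 ⊆ ε →
          (choiceSet (interior C) G ε).Nonempty → ∀ b,
            (choiceSet (interior C) G ε ∩ t.1 b).Nonempty := by
    intro α G
    let S : Set (Finset (W × Bool)) := {ε | ε ∈ below α ∧ (choiceSet (interior C) G ε).Nonempty}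
    have hS : S.Nonempty := ⟨∅, by simp [below], x₀, by simpa [choiceSet] using hx₀'⟩
    have hSc : S.Countable := (hbelow α).mono fun ε h => h.1
    obtain ⟨e, he⟩ := hSc.exists_eq_range hS
    obtain ⟨U, hU, ε₀, hε₀, h⟩ := exists_open_pair_meeting hCc.isCompact
      (choiceSet (interior C) G) hS
      (fun ε hε => ⟨hε.2, Set.inter_subset_left.trans interior_subset⟩)
      (choiceSet_antitone _ _) (fun x hx => by
        -- Otherwise the countably many nonempty choice sets form a π-base at `x`.
        by_contra! hcon
        refine hpi x (hCV hx) ⟨fun n => choiceSet (interior C) G (e n), fun n =>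
          ⟨isOpen_choiceSet hV' _ _, ?_⟩, fun O hO => ?_⟩
        · have : e n ∈ S := he ▸ ⟨n, rfl⟩
          exact this.2
        · obtain ⟨ε, hε, hεO⟩ := hcon O hO
          obtain ⟨n, rfl⟩ : ε ∈ Set.range e := he ▸ hε
          exact ⟨n, hεO⟩)
    exact ⟨(U, ε₀), hU, hε₀.1, hε₀.2, fun ε hε hsub hne b => h ε ⟨hε, hne⟩ hsub b⟩
  obtain ⟨F, hF⟩ := exists_transfinite_sequence (W := W)
    (fun α prev (t : (Bool → TopologicalSpace.Opens X) × Finset (W × Bool)) =>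
      Disjoint (closure (t.1 true : Set X)) (closure (t.1 false : Set X)) ∧ t.2 ∈ below α ∧
      let G : W → Bool → TopologicalSpace.Opens X :=
        fun β => if h : β < α then (prev β h).1 else fun _ => ⊤
      (choiceSet (interior C) G t.2).Nonempty ∧ ∀ ε ∈ below α, t.2 ⊆ ε →
          (choiceSet (interior C) G ε).Nonempty → ∀ b,
            (choiceSet (interior C) G ε ∩ t.1 b).Nonempty)
    (fun α prev => step α _)
  let G : W → Bool → TopologicalSpace.Opens X := fun α => (F α).1
  have hG : ∀ α, ∀ ε ∈ below α, choiceSet (interior C)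
      (fun β => if h : β < α then (F β).1 else fun _ => ⊤) ε = choiceSet (interior C) G ε := by
    intro α ε hε
    refine choiceSet_congr fun a ha => ?_
    simp only [dif_pos (hε a ha), G]
  -- On the uncountable set `T` the exceptional choices `e` are the same for all indices.
  obtain ⟨e, he⟩ := exists_uncountable_fiber hu (fun α => (F α).2) fun α => (hF α).2.1
  let T : Set W := {α | (F α).2 = e}
  have hTu : Uncountable T := by
    rw [← not_countable_iff]
    exact fun h => he (Set.countable_coe_iff.mp h)
  have hTne : T.Nonempty := by
    rw [Set.nonempty_iff_ne_empty]
    intro h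
    exact he (by rw [show {α | (F α).2 = e} = ∅ from h]; exact Set.countable_empty)
  have key : ∀ (σ : W → Bool) (Q : Finset W), (∀ α ∈ Q, α ∈ T) →
      (choiceSet (interior C) G (e ∪ Q.image fun α => (α, σ α))).Nonempty := by
    intro σ Q
    induction Q using Finset.induction_on_max with
    | empty =>
      intro _
      obtain ⟨α, hα⟩ := hTne
      obtain ⟨-, hb, hne, -⟩ := hF α
      rw [hG α _ hb] at hne
      simpa [show (F α).2 = e from hα] using hne
    | insert α Q hQ ih =>
      intro hT
      have hαT : (F α).2 = e := hT α (Finset.mem_insert_self _ _)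
      obtain ⟨-, hb, -, h⟩ := hF α
      have hb' : e ∪ Q.image (fun α => (α, σ α)) ∈ below α := by
        intro a ha
        rcases Finset.mem_union.mp ha with ha | ha
        · exact hb a (hαT ▸ ha)
        · obtain ⟨β, hβ, rfl⟩ := Finset.mem_image.mp ha
          exact hQ β hβ
      have := h _ hb' (hαT ▸ Finset.subset_union_left)
        (by rw [hG α _ hb']; exact ih fun β hβ => hT β (Finset.mem_insert_of_mem hβ)) (σ α)
      rw [hG α _ hb'] at this
      obtain ⟨x, ⟨hxC, hx⟩, hxα⟩ := this
      refine ⟨x, hxC, Set.mem_iInter₂.mpr fun a ha => ?_⟩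
      rw [Finset.image_insert, Finset.union_insert, Finset.mem_insert] at ha
      rcases ha with rfl | ha
      · exact hxα
      · exact Set.mem_iInter₂.mp hx a ha
  refine ⟨T, hTu, fun α b => closure (G α b : Set X), fun _ _ => isClosed_closure,
    fun α => (hF α).1, fun σ => ?_⟩
  refine CompactSpace.iInter_nonempty (fun _ => isClosed_closure) fun Q => ?_
  obtain ⟨x, -, hx⟩ := key (fun α => if h : α ∈ T then σ ⟨α, h⟩ else false)
    (Q.image Subtype.val) (by
      intro α hα
      obtain ⟨β, -, rfl⟩ := Finset.mem_image.mp hα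
      exact β.2)
  refine ⟨x, Set.mem_iInter₂.mpr fun α hα => subset_closure ?_⟩
  have := Set.mem_iInter₂.mp hx (α.1, σ α) (Finset.mem_union_right _
    (Finset.mem_image.mpr ⟨α.1, Finset.mem_image_of_mem _ hα, by simp⟩))
  exact this

theorem dense_hasCountablePiBase {X : Type*} [TopologicalSpace X] [CompactSpace X] [T2Space X]
    (C : ℕ → Set X) (hC : ⋃ m, C m = Set.univ) (hCt : ∀ m, CountablyTightOn (C m)) :
    Dense {x : X | HasCountablePiBase x} := by
  classical
  rw [dense_iff_inter_open]
  intro V hV hVne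
  by_contra hcon
  obtain ⟨T, hT, F, hFc, hFd, hF⟩ := exists_independent_family hV hVne
    fun x hx h => hcon ⟨x, hx, h⟩
  let K : Set X := {x | ∀ α, x ∈ F α true ∪ F α false}
  have hK : IsClosed K := by
    have : K = ⋂ α, (F α true ∪ F α false) := by
      ext x
      simp [K]
    rw [this]
    exact isClosed_iInter fun α => (hFc α true).union (hFc α false)
  have : CompactSpace K := isCompact_iff_compactSpace.mp hK.isCompact
  let f : K → T → Bool := fun x α => decide (x.1 ∈ F α true)
  have hf : Continuous f := by
    refine continuous_pi fun α => (continuous_bool_rng true).mpr ⟨?_, ?_⟩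
    · have : (fun x : K => f x α) ⁻¹' {true} = Subtype.val ⁻¹' F α true := by
        ext x
        simp [f]
      rw [this]
      exact (hFc α true).preimage continuous_subtype_val
    · have : (fun x : K => f x α) ⁻¹' {true} = (Subtype.val ⁻¹' F α false)ᶜ := by
        ext x
        have h1 := x.2 α
        have h2 : x.1 ∈ F α true → x.1 ∉ F α false := fun h => Set.disjoint_left.mp (hFd α) h
        simp only [f, Set.mem_preimage, Set.mem_singleton_iff, decide_eq_true_eq, Set.mem_compl_iff]
        exact ⟨h2, fun h => h1.resolve_right h⟩
      rw [this]
      exact ((hFc α false).preimage continuous_subtype_val).isOpen_compl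
  have hfs : Function.Surjective f := by
    intro σ
    obtain ⟨x, hx⟩ := hF σ
    rw [Set.mem_iInter] at hx
    refine ⟨⟨x, fun α => ?_⟩, funext fun α => ?_⟩
    · have := hx α
      cases h : σ α with
      | true => exact Or.inl (h ▸ this)
      | false => exact Or.inr (h ▸ this)
    · have := hx α
      cases h : σ α with
      | true =>
        rw [h] at this
        exact decide_eq_true this
      | false =>
        rw [h] at this
        exact decide_eq_false fun h' => Set.disjoint_left.mp (hFd α) h' this
  refine not_surjective_of_countablyTightOn hf hfs (fun m => Subtype.val ⁻¹' C m) ?_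
    fun m => (hCt m).preimage_val K
  rw [← Set.preimage_iUnion, hC, Set.preimage_univ]

/-! ### A closed Gδ set in the closure of a countable set -/

/-- The open sets `V n` contain `x`, and the closure of each lies in its predecessor; then
`⋂ n, V n` is a closed Gδ set. -/
def IsNestedAt {X : Type*} [TopologicalSpace X] (x : X) (V : ℕ → Set X) : Prop :=
  (∀ n, IsOpen (V n)) ∧ (∀ n, x ∈ V n) ∧ ∀ n, closure (V (n + 1)) ⊆ V n

theorem IsNestedAt.iInter_closure_subset {X : Type*} [TopologicalSpace X] {x : X} {V : ℕ → Set X}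
    (h : IsNestedAt x V) : ⋂ n, closure (V n) ⊆ ⋂ n, V n := fun _ hy =>
  Set.mem_iInter.mpr fun n => h.2.2 n (Set.mem_iInter.mp hy (n + 1))

theorem IsNestedAt.isClosed_iInter {X : Type*} [TopologicalSpace X] {x : X} {V : ℕ → Set X}
    (h : IsNestedAt x V) : IsClosed (⋂ n, V n) := by
  rw [(Set.iInter_mono fun n => subset_closure).antisymm h.iInter_closure_subset]
  exact _root_.isClosed_iInter fun n => isClosed_closure

theorem IsNestedAt.isGδ {X : Type*} [TopologicalSpace X] {x : X} {V : ℕ → Set X}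
    (h : IsNestedAt x V) : IsGδ (⋂ n, V n) := IsGδ.iInter_of_isOpen h.1

theorem IsGδ.exists_isNestedAt {X : Type*} [TopologicalSpace X] [RegularSpace X] {H : Set X}
    (hH : IsGδ H) {x : X} (hx : x ∈ H) : ∃ V, IsNestedAt x V ∧ ⋂ n, V n ⊆ H := by
  obtain ⟨U, hU, rfl⟩ := hH.eq_iInter_nat
  have hstep : ∀ (n : ℕ) (O : Set X), ∃ O' : Set X, IsOpen O ∧ x ∈ O →
      (IsOpen O' ∧ x ∈ O') ∧ closure O' ⊆ O ∩ U n := by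
    intro n O
    by_cases h : IsOpen O ∧ x ∈ O
    · obtain ⟨C, hC, hCc, hCO⟩ := exists_mem_nhds_isClosed_subset
        ((h.1.inter (hU n)).mem_nhds ⟨h.2, Set.mem_iInter.mp hx n⟩)
      exact ⟨interior C, fun _ => ⟨⟨isOpen_interior, mem_interior_iff_mem_nhds.mpr hC⟩,
        (closure_minimal interior_subset hCc).trans hCO⟩⟩
    · exact ⟨∅, fun h' => absurd h' h⟩
  choose g hg using hstep
  let V : ℕ → Set X := fun n => Nat.rec Set.univ (fun n O => g n O) n
  have hV : ∀ n, IsOpen (V n) ∧ x ∈ V n := by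
    intro n
    induction n with
    | zero => exact ⟨isOpen_univ, trivial⟩
    | succ n ih => exact (hg n (V n) ih).1
  have hcl : ∀ n, closure (V (n + 1)) ⊆ V n ∩ U n := fun n => (hg n (V n) (hV n)).2
  refine ⟨V, ⟨fun n => (hV n).1, fun n => (hV n).2, fun n => (hcl n).trans Set.inter_subset_left⟩,
    fun y hy => Set.mem_iInter.mpr fun n => ?_⟩
  exact (hcl n (subset_closure (Set.mem_iInter.mp hy (n + 1)))).2

/-- If there were no such set, there would be a free sequence `x α` of length `ω₁`. A common point
of the closures of its tails lies in some piece `C m`; countable tightness of that piece, applied to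
countable sets `S (x α) m ⊆ C m` with `x α` in their closures, puts it in the closure of the union
of the `S (x β) m` over an initial segment, from which the tails have been kept away. -/
theorem exists_isGδ_subset_closure_countable {X : Type*} [TopologicalSpace X] [CompactSpace X]
    [T2Space X] [Nonempty X] (C : ℕ → Set X) (hC : ⋃ m, C m = Set.univ)
    (hCt : ∀ m, CountablyTightOn (C m))
    (hdense : ∀ x m, ∃ S ⊆ C m, S.Countable ∧ x ∈ closure S) :
    ∃ H : Set X, H.Nonempty ∧ IsClosed H ∧ IsGδ H ∧ ∃ S : Set X, S.Countable ∧ H ⊆ closure S := by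
  by_contra! hcon
  choose S hSC hSc hxS using hdense
  obtain ⟨W, _, _, hW, hu, -⟩ := exists_omega_one_like.{0}
  let T : Type _ := {t : Set X × X // IsClosed t.1 ∧ IsGδ t.1 ∧ t.2 ∈ t.1}
  have x₀ : X := Classical.arbitrary X
  let R : ∀ α : W, (∀ β, β < α → T) → T → Prop := fun α prev t =>
    (∀ β γ (hβ : β < α) (hγ : γ < α), β ≤ γ → (prev γ hγ).1.1 ⊆ (prev β hβ).1.1) →
      (∀ β (hβ : β < α), t.1.1 ⊆ (prev β hβ).1.1) ∧
        Disjoint t.1.1 (closure (⋃ β, ⋃ hβ : β < α, ⋃ m, S (prev β hβ).1.2 m))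
  have step : ∀ α prev, ∃ t, R α prev t := by
    intro α prev
    by_cases hdec : ∀ β γ (hβ : β < α) (hγ : γ < α), β ≤ γ → (prev γ hγ).1.1 ⊆ (prev β hβ).1.1
    swap
    · exact ⟨⟨(Set.univ, x₀), isClosed_univ, IsGδ.univ, trivial⟩, fun h => absurd h hdec⟩
    have : Countable (Set.Iio α) := (hW α).to_subtype
    let H : Set.Iio α → Set X := fun β => (prev β.1 β.2).1.1
    have hHc : ∀ β, IsClosed (H β) := fun β => (prev β.1 β.2).2.1
    have hHne : (⋂ β, H β).Nonempty := by
      rcases isEmpty_or_nonempty (Set.Iio α) with h | h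
      · rw [Set.iInter_of_empty]
        exact Set.univ_nonempty
      · refine IsCompact.nonempty_iInter_of_directed_nonempty_isCompact_isClosed H ?_
          (fun β => ⟨_, (prev β.1 β.2).2.2.2⟩) (fun β => (hHc β).isCompact) hHc
        intro β γ
        rcases le_total β γ with hle | hle
        · exact ⟨γ, hdec _ _ _ _ hle, subset_rfl⟩
        · exact ⟨β, subset_rfl, hdec _ _ _ _ hle⟩
    have hHG : IsGδ (⋂ β, H β) := IsGδ.iInter fun β => (prev β.1 β.2).2.2.1
    have hD : (⋃ β, ⋃ hβ : β < α, ⋃ m, S (prev β hβ).1.2 m).Countable := by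
      refine (Set.countable_iUnion fun β : Set.Iio α => Set.countable_iUnion fun m =>
        hSc (prev β.1 β.2).1.2 m).mono ?_
      intro y hy
      simp only [Set.mem_iUnion] at hy ⊢
      obtain ⟨β, hβ, m, hm⟩ := hy
      exact ⟨⟨β, hβ⟩, m, hm⟩
    obtain ⟨x, hx, hxD⟩ := Set.not_subset.mp
      (hcon _ hHne (isClosed_iInter hHc) hHG _ hD)
    obtain ⟨V, hV, hVsub⟩ := (hHG.inter isClosed_closure.isOpen_compl.isGδ).exists_isNestedAt
      (show x ∈ (⋂ β, H β) ∩ (closure _)ᶜ from ⟨hx, hxD⟩)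
    refine ⟨⟨(⋂ n, V n, x), hV.isClosed_iInter, hV.isGδ, Set.mem_iInter.mpr hV.2.1⟩, fun _ =>
      ⟨fun β hβ y hy => Set.mem_iInter.mp (hVsub hy).1 ⟨β, hβ⟩, ?_⟩⟩
    exact Set.disjoint_left.mpr fun y hy => (hVsub hy).2
  obtain ⟨F, hF⟩ := exists_transfinite_sequence (W := W) R step
  have hdec : ∀ γ β, β ≤ γ → (F γ).1.1 ⊆ (F β).1.1 := by
    intro γ
    induction γ using WellFoundedLT.induction with
    | ind γ ih =>
      intro β hβ
      rcases hβ.eq_or_lt with rfl | hlt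
      · exact subset_rfl
      · exact (hF γ fun β' γ' _ hγ' hle => ih γ' hγ' β' hle).1 β hlt
  have hdisj : ∀ γ, Disjoint (F γ).1.1 (closure (⋃ β, ⋃ _ : β < γ, ⋃ m, S (F β).1.2 m)) :=
    fun γ => (hF γ fun β' γ' _ _ hle => hdec γ' β' hle).2
  have hWne : Nonempty W := ⟨(exists_forall_lt_of_countable hW hu Set.countable_empty).choose⟩
  obtain ⟨p, hp⟩ := IsCompact.nonempty_iInter_of_directed_nonempty_isCompact_isClosed
    (fun α => closure ((fun β => (F β).1.2) '' Set.Ici α))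
    (by
      intro β γ
      rcases le_total β γ with hle | hle
      · exact ⟨γ, closure_mono (Set.image_mono (Set.Ici_subset_Ici.mpr hle)), subset_rfl⟩
      · exact ⟨β, subset_rfl, closure_mono (Set.image_mono (Set.Ici_subset_Ici.mpr hle))⟩)
    (fun α => ⟨_, subset_closure ⟨α, Set.mem_Ici.mpr le_rfl, rfl⟩⟩)
    (fun α => isClosed_closure.isCompact) (fun α => isClosed_closure)
  rw [Set.mem_iInter] at hp
  have hpF : ∀ α, p ∈ (F α).1.1 := fun α => by
    refine closure_minimal ?_ (F α).2.1 (hp α)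
    rintro _ ⟨β, hβ, rfl⟩
    exact hdec β α hβ (F β).2.2.2
  obtain ⟨m, hm⟩ := Set.mem_iUnion.mp (hC.symm ▸ Set.mem_univ p : p ∈ ⋃ m, C m)
  have hpS : p ∈ closure (⋃ β, S (F β).1.2 m) := by
    refine closure_minimal ?_ isClosed_closure (hp hWne.some)
    rintro _ ⟨β, -, rfl⟩
    exact closure_mono (Set.subset_iUnion (fun β => S (F β).1.2 m) β) (hxS _ m)
  obtain ⟨B, hB, hBc, hpB⟩ := hCt m _ (Set.iUnion_subset fun β => hSC _ m) p hm hpS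
  have hb : ∀ y : B, ∃ β, y.1 ∈ S (F β).1.2 m := fun y => Set.mem_iUnion.mp (hB y.2)
  choose b hb using hb
  have := hBc.to_subtype
  obtain ⟨α, hα⟩ := exists_forall_lt_of_countable hW hu (Set.countable_range b)
  refine Set.disjoint_left.mp (hdisj α) (hpF α) (closure_mono (fun y hy => ?_) hpB)
  simp only [Set.mem_iUnion]
  exact ⟨b ⟨y, hy⟩, hα _ ⟨_, rfl⟩, m, hb ⟨y, hy⟩⟩

/-! ### Transport by homogeneity of a power -/

theorem IsNestedAt.antitone {X : Type*} [TopologicalSpace X] {x : X} {V : ℕ → Set X}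
    (h : IsNestedAt x V) : Antitone V :=
  antitone_nat_of_succ_le fun n => subset_closure.trans (h.2.2 n)

/-- If `p` lies in a closed Gδ set within the closure of a countable set, then so does every image
of the constant point `p` under an open map on a power. On a countable set `A` of coordinates the
map is controlled at the countably many points with finitely many coordinates from that countable
set and the others equal to `p`, hence on all points whose coordinates in `A` lie in the Gδ set. -/
theorem exists_isNestedAt_of_open_map {ι X : Type*} [TopologicalSpace X] [CompactSpace X]
    [T2Space X]
    (hpi : ∀ x : X, HasCountablePiBase x) {f : (ι → X) → X} (hf : Continuous f)
    (hfo : IsOpenMap f) {p : X} {H S : Set X} (hH : IsGδ H) (hp : p ∈ H) (hS : S.Countable)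
    (hHS : H ⊆ closure S) :
    ∃ V, IsNestedAt (f fun _ => p) V ∧ ∃ S' : Set X, S'.Countable ∧ ⋂ n, V n ⊆ closure S' := by
  classical
  obtain ⟨e, he⟩ := (hS.insert p).exists_eq_range (Set.insert_nonempty p S)
  let σ : ℕ → X := fun n => Nat.casesOn n p e
  have hσS : ∀ y ∈ S, ∃ n, σ n = y := fun y hy => by
    obtain ⟨n, hn⟩ : y ∈ Set.range e := he ▸ Set.mem_insert_of_mem p hy
    exact ⟨n + 1, hn⟩
  let pt : (ι →₀ ℕ) → ι → X := fun s i => σ (s i)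
  choose Ax hAx hfAx using fun s : ι →₀ ℕ => exists_countable_forall_eq hf hfo (pt s)
    (fun i => hpi _) dense_univ fun y _ => hpi y
  obtain ⟨A, hA, hAcl⟩ := exists_countable_closed_under
    (fun G : Finset ι => ⋃ s ∈ {s : ι →₀ ℕ | (s.support : Set ι) ⊆ G}, Ax s)
    (fun G => (countable_setOf_finsupp_support_subset G.countable_toSet).biUnion fun s _ => hAx s)
  have hAxA : ∀ s : ι →₀ ℕ, (s.support : Set ι) ⊆ A → Ax s ⊆ A := fun s hs i hi =>
    hAcl s.support hs (Set.mem_biUnion (x := s) (by simp) hi)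
  obtain ⟨c, hc⟩ := Set.countable_iff_exists_injOn.mp hA
  obtain ⟨G, hG, hGH⟩ := hH.exists_isNestedAt hp
  let I : ℕ → Set ι := fun n => {i | i ∈ A ∧ c i ≤ n}
  have hIfin : ∀ n, (I n).Finite := fun n =>
    Set.Finite.of_finite_image ((Set.finite_Iic n).subset (by rintro _ ⟨i, hi, rfl⟩; exact hi.2))
      (hc.mono fun i hi => hi.1)
  let L : ℕ → Set (ι → X) := fun n => (I n).pi fun _ => G n
  have hLo : ∀ n, IsOpen (L n) := fun n => isOpen_set_pi (hIfin n) fun _ _ => hG.1 n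
  have hLcl : ∀ n, closure (L (n + 1)) ⊆ L n := by
    intro n x hx i hi
    rw [closure_pi_set] at hx
    exact hG.2.2 n (hx i ⟨hi.1, hi.2.trans n.le_succ⟩)
  have hLanti : Antitone L := antitone_nat_of_succ_le fun n => subset_closure.trans (hLcl n)
  refine ⟨fun n => f '' L n, ⟨fun n => hfo _ (hLo n), fun n => ⟨_, fun _ _ => hG.2.1 n, rfl⟩,
    fun n => ?_⟩, (fun s => f (pt s)) '' {s | (s.support : Set ι) ⊆ A},
    (countable_setOf_finsupp_support_subset hA).image _, fun y hy => ?_⟩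
  · have : IsClosed (f '' closure (L (n + 1))) :=
      (isClosed_closure.isCompact.image hf).isClosed
    exact (closure_minimal (Set.image_mono subset_closure) this).trans (Set.image_mono (hLcl n))
  · obtain ⟨x, hx⟩ := IsCompact.nonempty_iInter_of_sequence_nonempty_isCompact_isClosed
      (fun n => closure (L n) ∩ f ⁻¹' {y})
      (fun n => Set.inter_subset_inter_left _ (closure_mono (hLanti n.le_succ)))
      (fun n => by
        obtain ⟨x, hx, hxy⟩ := Set.mem_iInter.mp hy n
        exact ⟨x, subset_closure hx, hxy⟩)
      (isClosed_closure.inter (isClosed_singleton.preimage hf)).isCompact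
      (fun n => isClosed_closure.inter (isClosed_singleton.preimage hf))
    rw [Set.mem_iInter] at hx
    have hxH : ∀ i ∈ A, x i ∈ closure S := fun i hi => hHS (hGH (Set.mem_iInter.mpr fun n =>
      hG.antitone (le_max_left n (c i)) (hLcl _ (hx _).1 i ⟨hi, le_max_right n (c i)⟩)))
    -- Replace finitely many coordinates in `A` by points of `S`, and the rest of `A` by `p`.
    have hxE : x ∈ closure {w | ∃ s : ι →₀ ℕ, (s.support : Set ι) ⊆ A ∧ ∀ i ∈ A, w i = pt s i} := by
      rw [mem_closure_iff]
      intro O hO hxO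
      obtain ⟨F, Wb, hW, hF⟩ := exists_finset_forall_eq_mem hO hxO
      have hn : ∀ i, ∃ n, i ∈ A → σ n ∈ Wb i := by
        intro i
        by_cases hi : i ∈ A
        · obtain ⟨z, hz, hzS⟩ := mem_closure_iff.mp (hxH i hi) (Wb i) (hW i).1 (hW i).2
          obtain ⟨n, rfl⟩ := hσS z hzS
          exact ⟨n, fun _ => hz⟩
        · exact ⟨0, fun h => absurd h hi⟩
      choose n hn using hn
      let s : ι →₀ ℕ := Finsupp.onFinset (F.filter (· ∈ A))
        (fun i => if i ∈ F ∧ i ∈ A then n i else 0) (fun i hi => by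
          by_contra h
          rw [Finset.mem_filter] at h
          exact hi (if_neg h))
      refine ⟨fun i => if i ∈ A then pt s i else x i, hF _ fun i hi => ?_, s, fun i hi => ?_,
        fun i hi => if_pos hi⟩
      · by_cases hiA : i ∈ A
        · simpa [hiA, hi, pt, s] using hn i hiA
        · simpa [hiA] using (hW i).2
      · exact (Finset.mem_filter.mp (Finsupp.support_onFinset_subset hi)).2
    have hfx : f x = y := (hx 0).2
    rw [← hfx]
    refine closure_mono ?_ (image_closure_subset_closure_image hf ⟨x, hxE, rfl⟩)
    rintro _ ⟨w, ⟨s, hs, hw⟩, rfl⟩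
    exact ⟨s, hs, (hfAx s w fun i hi => hw i (hAxA s hs hi)).symm⟩

/-! ### Density and cardinality -/

/-- A compact space in which every point lies in a nested Gδ set within the closure of a countable
set has density at most `𝔠`, given the cover by countably tight pieces. A subset `Y` of size `𝔠`
is closed off so that the Gδ sets at points of `Y` cover the space; the closure of a countable set
`S` needs at most `𝔠` of them, because the Gδ set at `z` is determined in that closure by the
traces of its defining open sets on `S`. -/
theorem exists_dense_card_le_continuum {X : Type u} [TopologicalSpace X] [CompactSpace X]
    [T2Space X] (C : ℕ → Set X) (hC : ⋃ m, C m = Set.univ) (hCt : ∀ m, CountablyTightOn (C m))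
    (hdense : ∀ x m, ∃ S ⊆ C m, S.Countable ∧ x ∈ closure S)
    (hnest : ∀ q : X, ∃ V, IsNestedAt q V ∧
      ∃ S : Set X, S.Countable ∧ ⋂ n, V n ⊆ closure S) :
    ∃ D : Set X, Dense D ∧ #D ≤ 𝔠 := by
  classical
  rcases isEmpty_or_nonempty X with hX | ⟨⟨x₀⟩⟩
  · exact ⟨∅, fun x => hX.elim x, by simp⟩
  choose S hSC hSc hxS using hdense
  choose V hV E hEc hVE using hnest
  have hQ : ∀ s : ℕ → X, ∃ Q : Set X, #Q ≤ 𝔠 ∧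
      ∀ z ∈ closure (Set.range s), ∃ q ∈ Q, z ∈ ⋂ n, V q n := by
    intro s
    let tr : closure (Set.range s) → ℕ → Set ℕ := fun z n => {k | s k ∈ V z.1 n}
    have hsel : ∀ r : Set.range tr, ∃ z, tr z = r := fun r => r.2
    choose g hg using hsel
    refine ⟨Set.range fun r => (g r).1, ?_, fun z hz => ?_⟩
    · have h1 : lift.{0} #(Set.range fun r => (g r).1) ≤ lift.{u} #(Set.range tr) :=
        mk_range_le_lift
      have h2 : #(Set.range tr) ≤ 𝔠 := by
        refine (mk_set_le _).trans ?_
        simp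
      rw [lift_id'] at h1
      exact h1.trans ((lift_le.mpr h2).trans_eq (by simp))
    · let r : Set.range tr := ⟨tr ⟨z, hz⟩, Set.mem_range_self _⟩
      refine ⟨(g r).1, ⟨r, rfl⟩, (hV _).iInter_closure_subset (Set.mem_iInter.mpr fun n => ?_)⟩
      rw [mem_closure_iff]
      intro O hO hzO
      obtain ⟨_, ⟨hyO, hyV⟩, k, rfl⟩ := mem_closure_iff.mp hz (O ∩ V z n)
        (hO.inter ((hV z).1 n)) ⟨hzO, (hV z).2.1 n⟩
      have : k ∈ tr (g r) n := by
        rw [hg r]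
        exact hyV
      exact ⟨s k, hyO, this⟩
  choose Q hQc hQ using hQ
  let out : Set X → X := fun Z => if h : ∃ x, x ∉ Z then h.choose else x₀
  have hout : ∀ Z : Set X, Z ≠ Set.univ → out Z ∉ Z := by
    intro Z hZ
    have h : ∃ x, x ∉ Z := by
      rwa [Set.ne_univ_iff_exists_notMem] at hZ
    simp only [out, dif_pos h]
    exact h.choose_spec
  have hctble : ∀ Z : Set X, Z.Countable → #Z ≤ 𝔠 := fun Z hZ =>
    (le_aleph0_iff_set_countable.mpr hZ).trans aleph0_le_continuum
  obtain ⟨Y, hYc, hx₀Y, hY⟩ := exists_closed_under_sequences {x₀}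
    (hctble _ (Set.countable_singleton _))
    (fun s => Q s ∪ ((⋃ m, S (s 0) m) ∪
      Set.range fun t : Finset (ℕ × ℕ) => out (⋃ a ∈ t, V (s a.1) a.2)))
    (fun s => by
      refine (mk_union_le _ _).trans
        ((add_le_add (hQc s) (hctble _ ?_)).trans_eq continuum_add_self)
      exact (Set.countable_iUnion fun m => hSc _ m).union (Set.countable_range _))
  have hx₀Y : x₀ ∈ Y := hx₀Y rfl
  have hYS : ∀ m, Y ⊆ closure (C m ∩ Y) := by
    intro m y hy
    refine closure_mono (fun z hz => Set.mem_inter (hSC y m hz) ?_) (hxS y m)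
    exact hY (fun _ => y) (fun _ => hy) (Or.inr (Or.inl (Set.mem_iUnion.mpr ⟨m, hz⟩)))
  have hYcov : ∀ z ∈ closure Y, ∃ q ∈ Y, z ∈ ⋂ n, V q n := by
    intro z hz
    obtain ⟨m, hm⟩ := Set.mem_iUnion.mp (hC.symm ▸ Set.mem_univ z : z ∈ ⋃ m, C m)
    obtain ⟨B, hB, hBc, hzB⟩ := hCt m _ Set.inter_subset_left z hm
      (closure_minimal (hYS m) isClosed_closure hz)
    obtain ⟨s, rfl⟩ := hBc.exists_eq_range (closure_nonempty_iff.mp ⟨z, hzB⟩)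
    obtain ⟨q, hq, hzq⟩ := hQ s z hzB
    exact ⟨q, hY s (fun n => (hB ⟨n, rfl⟩).2) (Or.inl hq), hzq⟩
  have hcov : ∀ x, ∃ q ∈ Y, x ∈ ⋂ n, V q n := by
    by_contra! hcon
    obtain ⟨x, hx⟩ := hcon
    have hn : ∀ z : X, ∃ q n, z ∈ closure Y → q ∈ Y ∧ z ∈ V q n ∧ x ∉ V q n := by
      intro z
      by_cases hz : z ∈ closure Y
      · obtain ⟨q, hq, hzq⟩ := hYcov z hz
        have hxq := hx q hq
        rw [Set.mem_iInter, not_forall] at hxq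
        obtain ⟨n, hn⟩ := hxq
        exact ⟨q, n, fun _ => ⟨hq, Set.mem_iInter.mp hzq n, hn⟩⟩
      · exact ⟨x₀, 0, fun h => absurd h hz⟩
    choose q n hqn using hn
    obtain ⟨t, htY, htcov⟩ := (isClosed_closure (s := Y)).isCompact.elim_nhds_subcover
      (fun z => V (q z) (n z)) fun z hz => ((hV _).1 _).mem_nhds (hqn z hz).2.1
    -- The finitely many centres are coded by one sequence in `Y`.
    obtain ⟨s, hs⟩ := (t.countable_toSet.image q).insert x₀ |>.exists_eq_range
      (Set.insert_nonempty _ _)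
    have hsY : ∀ k, s k ∈ Y := by
      intro k
      rcases (hs ▸ ⟨k, rfl⟩ : s k ∈ insert x₀ (q '' (t : Set X))) with h | ⟨z, hz, h⟩
      · rw [h]
        exact hx₀Y
      · rw [← h]
        exact (hqn z (htY z hz)).1
    have hk : ∀ z : X, ∃ k, z ∈ t → s k = q z := by
      intro z
      by_cases hz : z ∈ t
      · obtain ⟨k, hk⟩ : q z ∈ Set.range s :=
          hs ▸ Set.mem_insert_of_mem x₀ (Set.mem_image_of_mem q hz)
        exact ⟨k, fun _ => hk⟩
      · exact ⟨0, fun h => absurd h hz⟩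
    choose k hk using hk
    let Z : Set X := ⋃ a ∈ t.image fun z => (k z, n z), V (s a.1) a.2
    have hZ : ∀ y, y ∈ Z ↔ ∃ z ∈ t, y ∈ V (q z) (n z) := by
      intro y
      simp only [Z, Set.mem_iUnion, Finset.mem_image, exists_prop]
      constructor
      · rintro ⟨_, ⟨z, hz, rfl⟩, hy⟩
        exact ⟨z, hz, hk z hz ▸ hy⟩
      · rintro ⟨z, hz, hy⟩
        exact ⟨_, ⟨z, hz, rfl⟩, by rwa [hk z hz]⟩
    have hxZ : x ∉ Z := by
      rw [hZ]
      rintro ⟨z, hz, hxz⟩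
      exact (hqn z (htY z hz)).2.2 hxz
    have houtY : out Z ∈ Y := hY s hsY (Or.inr (Or.inr ⟨_, rfl⟩))
    refine hout Z (fun h => hxZ (h ▸ Set.mem_univ x)) ?_
    obtain ⟨z, hz, hoz⟩ := Set.mem_iUnion₂.mp (htcov (subset_closure houtY))
    exact (hZ _).mpr ⟨z, hz, hoz⟩
  refine ⟨⋃ q ∈ Y, E q, fun x => ?_, ?_⟩
  · obtain ⟨q, hq, hx⟩ := hcov x
    exact closure_mono (Set.subset_biUnion_of_mem (u := E) hq) (hVE q hx)
  · refine (mk_biUnion_le _ _).trans ?_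
    exact (mul_le_mul' hYc (ciSup_le' fun q : Y => hctble _ (hEc q))).trans_eq continuum_mul_self

/-- A point `q` that is the image of `p` under an open map on a power is determined by one point of
`D` for each box of the π-base at `p`; boxes are indexed by `ℕ →₀ ℕ` after the relevant countable
set of coordinates, which depends on `q`, is injected into `ℕ`. -/
theorem card_le_continuum_of_open_maps {ι : Type v} {X : Type u} [TopologicalSpace X]
    [CompactSpace X] [T2Space X] (hpi : ∀ x : X, HasCountablePiBase x) {D : Set X} (hD : Dense D)
    (hDc : #D ≤ 𝔠) (p : X)
    (hf : ∀ q : X, ∃ f : (ι → X) → X, Continuous f ∧ IsOpenMap f ∧ f (fun _ => p) = q) :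
    #X ≤ 𝔠 := by
  classical
  choose f hf hfo hfp using hf
  obtain ⟨U, hU, hU0⟩ := (hpi p).exists_zero_eq_univ
  choose A hA d hdD hd using fun q => exists_countable_support_of_open_map (hf q) (hfo q)
    (fun _ => p) (fun _ => U) (fun _ => hU) (fun _ => hU0) hD fun y _ => hpi y
  choose c hc using fun q => Set.countable_iff_exists_injOn.mp (hA q)
  have hs : ∀ (q : X) (t : ℕ →₀ ℕ), ∃ s : ι →₀ ℕ, (s.support : Set ι) ⊆ A q ∧
      ∀ i ∈ A q, s i = t (c q i) := by
    intro q t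
    have hfin : {i | i ∈ A q ∧ t (c q i) ≠ 0}.Finite :=
      Set.Finite.of_finite_image (t.support.finite_toSet.subset (by
        rintro _ ⟨i, hi, rfl⟩
        exact Finsupp.mem_support_iff.mpr hi.2)) ((hc q).mono fun i hi => hi.1)
    refine ⟨Finsupp.onFinset hfin.toFinset (fun i => if i ∈ A q then t (c q i) else 0) ?_, ?_, ?_⟩
    · intro i hi
      rw [Set.Finite.mem_toFinset]
      by_cases hiA : i ∈ A q
      · exact ⟨hiA, by simpa [hiA] using hi⟩
      · exact absurd (if_neg hiA) hi
    · intro i hi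
      exact ((Set.Finite.mem_toFinset hfin).mp (Finsupp.support_onFinset_subset hi)).1
    · intro i hi
      simp [hi]
  choose s hsA hs using hs
  have hinj : Function.Injective fun (q : X) (t : ℕ →₀ ℕ) => (⟨d q (s q t), hdD q _⟩ : D) := by
    intro q q' hqq'
    by_contra hne
    obtain ⟨O, hO, O', hO', hdisj⟩ := exists_nhds_disjoint_closure hne
    obtain ⟨G, T, hT, h⟩ := hd q _ (fun _ _ => rfl) O (by rwa [hfp])
    obtain ⟨G', T', hT', h'⟩ := hd q' _ (fun _ _ => rfl) O' (by rwa [hfp])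
    let N : ℕ → Set X := fun n => (⋂ i ∈ G.filter (c q · = n), T i) ∩
      ⋂ i ∈ G'.filter (c q' · = n), T' i
    have hN : ∀ n, N n ∈ nhds p := fun n => Filter.inter_mem
      ((Filter.biInter_finset_mem _).mpr fun i _ => hT i)
      ((Filter.biInter_finset_mem _).mpr fun i _ => hT' i)
    obtain ⟨t, -, ht⟩ := exists_finsupp_forall_subset (x := fun _ : ℕ => p) (fun _ => hU) Set.univ
      (G.image (c q) ∪ G'.image (c q')) hN
    have h1 := h (s q t) (hsA q t) fun i hi hiA => by
      rw [hs q t i hiA]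
      refine (ht (c q i) (Finset.mem_union_left _ (Finset.mem_image_of_mem _ hi)) trivial).trans ?_
      exact Set.inter_subset_left.trans
        (Set.biInter_subset_of_mem (Finset.mem_filter.mpr ⟨hi, rfl⟩))
    have h2 := h' (s q' t) (hsA q' t) fun i hi hiA => by
      rw [hs q' t i hiA]
      refine (ht (c q' i) (Finset.mem_union_right _ (Finset.mem_image_of_mem _ hi))
        trivial).trans ?_
      exact Set.inter_subset_right.trans
        (Set.biInter_subset_of_mem (Finset.mem_filter.mpr ⟨hi, rfl⟩))
    have heq : d q (s q t) = d q' (s q' t) := congrArg Subtype.val (congrFun hqq' t)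
    exact Set.disjoint_left.mp hdisj h1 (heq ▸ h2)
  refine (mk_le_of_injective hinj).trans ?_
  have : #((ℕ →₀ ℕ) → D) = #D ^ (ℵ₀ : Cardinal.{u}) := by simp
  rw [this, ← continuum_power_aleph0]
  exact power_le_power_right hDc

/-! ### The invariants in terms of countable sets -/

theorem IsCountablyTight.countablyTightOn {X : Type u} [TopologicalSpace X] {C : Set X}
    (hC : IsCountablyTight C) : CountablyTightOn C := by
  have hmem : tightness C ∈ {κ : Cardinal.{u} | ℵ₀ ≤ κ ∧ ∀ A : Set C, ∀ x ∈ closure A,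
      ∃ B : Set C, B ⊆ A ∧ #B ≤ κ ∧ x ∈ closure B} := by
    refine csInf_mem (α := Cardinal.{u}) (Set.nonempty_iff_ne_empty.mpr fun h => ?_)
    have h0 : tightness C = 0 := by
      unfold tightness
      rw [h, Cardinal.sInf_empty]
    exact aleph0_ne_zero (hC.symm.trans h0)
  rw [show tightness C = ℵ₀ from hC] at hmem
  have hemb : Topology.IsEmbedding (Subtype.val : C → X) := Topology.IsEmbedding.subtypeVal
  intro A hA x hx hxA
  obtain ⟨B, hB, hBc, hxB⟩ := hmem.2 (Subtype.val ⁻¹' A) ⟨x, hx⟩ (by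
    rw [hemb.closure_eq_preimage_closure_image, Set.mem_preimage, Subtype.image_preimage_coe,
      Set.inter_eq_right.mpr hA]
    exact hxA)
  refine ⟨Subtype.val '' B, ?_, (le_aleph0_iff_set_countable.mp hBc).image _, ?_⟩
  · rintro _ ⟨b, hb, rfl⟩
    exact hB hb
  · rw [hemb.closure_eq_preimage_closure_image] at hxB
    exact hxB

theorem HasCountablePiBase.exists_countable_subset {X : Type*} [TopologicalSpace X] {x : X}
    (hx : HasCountablePiBase x) {C : Set X} (hC : Dense C) :
    ∃ S ⊆ C, S.Countable ∧ x ∈ closure S := by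
  obtain ⟨U, hU, hUx⟩ := hx
  choose y hyU hyC using fun n => hC.inter_open_nonempty (U n) (hU n).1 (hU n).2
  refine ⟨Set.range y, Set.range_subset_iff.mpr hyC, Set.countable_range y, ?_⟩
  rw [mem_closure_iff_nhds]
  intro O hO
  obtain ⟨n, hn⟩ := hUx O hO
  exact ⟨y n, hn (hyU n), n, rfl⟩

theorem isAlmostCountablyTight_of_cover {X : Type u} [TopologicalSpace X]
    (hpi : ∀ x : X, HasCountablePiBase x) {𝒞 : Set (Set X)} (h𝒞 : 𝒞.Countable)
    (hcov : ⋃₀ 𝒞 = Set.univ) (hC : ∀ C ∈ 𝒞, Dense C ∧ IsCountablyTight C) :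
    IsAlmostCountablyTight X := by
  have hmem : ℵ₀ ∈ {κ : Cardinal.{u} | ℵ₀ ≤ κ ∧ ∃ 𝒞 : Set (Set X), ⋃₀ 𝒞 = Set.univ ∧ #𝒞 ≤ κ ∧
      ∀ C ∈ 𝒞, tightness C ≤ κ ∧ kappaClosure κ C = Set.univ} := by
    refine ⟨le_rfl, 𝒞, hcov, le_aleph0_iff_set_countable.mpr h𝒞, fun C hCm =>
      ⟨(hC C hCm).2.le, Set.eq_univ_of_forall fun x => ?_⟩⟩
    obtain ⟨S, hSC, hS, hxS⟩ := (hpi x).exists_countable_subset (hC C hCm).1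
    exact ⟨S, hSC, le_aleph0_iff_set_countable.mpr hS, hxS⟩
  exact le_antisymm (csInf_le' hmem) (le_csInf ⟨_, hmem⟩ fun κ hκ => hκ.1)

theorem corollary3p18 (X : Type u) [TopologicalSpace X] [CompactSpace X] [T2Space X]
    (hX : IsPowerHomogeneous.{u, v} X)
    (hcover : ∃ 𝒞 : Set (Set X), 𝒞.Countable ∧ ⋃₀ 𝒞 = Set.univ ∧
      ∀ C ∈ 𝒞, Dense C ∧ IsCountablyTight C) :
    IsAlmostCountablyTight X ∧ #X ≤ 𝔠 := by
  obtain ⟨𝒞, h𝒞, hcov, hC⟩ := hcover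
  rcases isEmpty_or_nonempty X with hXe | hXne
  · exact ⟨isAlmostCountablyTight_of_cover (fun x => hXe.elim x) h𝒞 hcov hC, by simp⟩
  have h𝒞ne : 𝒞.Nonempty := by
    rw [Set.nonempty_iff_ne_empty]
    rintro rfl
    rw [Set.sUnion_empty] at hcov
    exact Set.empty_ne_univ hcov
  obtain ⟨C, rfl⟩ := h𝒞.exists_eq_range h𝒞ne
  rw [Set.sUnion_range] at hcov
  have hCd : ∀ m, Dense (C m) := fun m => (hC _ ⟨m, rfl⟩).1
  have hCt : ∀ m, CountablyTightOn (C m) := fun m => (hC _ ⟨m, rfl⟩).2.countablyTightOn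
  obtain ⟨ι, ⟨i₀⟩, hhom⟩ := hX
  have hmap : ∀ p q : X, ∃ f : (ι → X) → X, Continuous f ∧ IsOpenMap f ∧ f (fun _ => p) = q := by
    intro p q
    obtain ⟨h, hh⟩ := hhom (fun _ => p) fun _ => q
    exact ⟨fun x => h x i₀, (continuous_apply i₀).comp h.continuous,
      (isOpenMap_eval i₀).comp h.isOpenMap, congrFun hh i₀⟩
  have hdense := dense_hasCountablePiBase C hcov hCt
  have hpi : ∀ x : X, HasCountablePiBase x := by
    intro q
    obtain ⟨p, hp⟩ := hdense.nonempty
    obtain ⟨f, hf, hfo, rfl⟩ := hmap p q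
    exact hasCountablePiBase_of_open_map hf hfo _ (fun _ => hp) hdense fun y hy => hy
  refine ⟨isAlmostCountablyTight_of_cover hpi h𝒞 (by rw [Set.sUnion_range, hcov]) hC, ?_⟩
  have hcl : ∀ x m, ∃ S ⊆ C m, S.Countable ∧ x ∈ closure S := fun x m =>
    (hpi x).exists_countable_subset (hCd m)
  obtain ⟨H, ⟨p, hp⟩, -, hHG, S, hS, hHS⟩ := exists_isGδ_subset_closure_countable C hcov hCt hcl
  obtain ⟨D, hD, hDc⟩ := exists_dense_card_le_continuum C hcov hCt hcl fun q => by
    obtain ⟨f, hf, hfo, rfl⟩ := hmap p q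
    exact exists_isNestedAt_of_open_map hpi hf hfo hHG hp hS hHS
  exact card_le_continuum_of_open_maps hpi hD hDc p (hmap p)
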